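/- Let $D\ge 1$ and $n_1,\dots,n_D\ge 1$ be integers, put $N=\sum_{d=1}^D n_d$ and $n_*=\max\{n_1,\dots,n_D\}$, and assume $N\ge 2$ (that is, exclude only the case $D=n_1=1$ of a single number). For a tensor $X\in\mathbb R^{n_1\times\cdots\times n_D}$ let $X_{(d)}$ be its mode-$d$ matricization (an $n_d\times\prod_{j\ne d}n_j$ matrix), let $\sigma^{(d)}(X)\in\mathbb R^{n_d}$ be the vector of its singular values in decreasing order (completed by zeros), and let $\sigma(X)=\frac1{\sqrt D}(\sigma^{(1)}(X),\dots,\sigma^{(D)}(X))\in\mathbb R^N$. For $\alpha\ge 0$ the dual Romera-Paredes--Pontil function is $$\omega_\alpha^*(g)=\sup_{\|s\|_2\le\alpha}\ \langle g,s\rangle-\|s\|_0\quad(g\in\mathbb R^N),\qquad \omega_\alpha^*(X):=\omega_\alpha^*(\sigma(X)),$$ where $\|s\|_0$ is the number of nonzero coordinates of $s$. Let $X$ be a random tensor with i.i.d. standard Gaussian entries and let $\alpha\ge 0$. Then $\omega_\alpha^*(X)$ is integrable. Moreover, let $r\in\{1,\dots,N\}$ and let $c$ be either of the binomial coefficients $\binom{r-1}{D-1}$,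 $\binom{D-1}{r-1}$, provided that it is nonzero, and put $$p=c\,3^{\,r n_*},\qquad q=r n_*+\Big(\frac rD\Big)^D .$$ Then $$\mathbb E\left[\omega_\alpha^*(X)\right]\le 8\sqrt2\,\alpha\,\Bigg[\sqrt{\log p}\;\frac{(1+N)^{D+1}-2^{D+1}}{D+1}+\frac14\sqrt{\pi q}\,\Big(N+\frac{N(1+N)^D-2^D}{D}+\frac{2^{D+1}-(1+N)^{D+1}}{D(D+1)}\Big)-\frac{N(1+N)}2\Bigg].$$ -/

import Mathlib

open MeasureTheory ProbabilityTheory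

noncomputable section

/-- Real `n 0 × ⋯ × n (D - 1)` tensors: arrays indexed by the multi-indices `(i_d)_d`. -/
abbrev RealTensor {D : ℕ} (n : Fin D → ℕ) : Type := ((d : Fin D) → Fin (n d)) → ℝ

/-- The mode-`d` matricization: rows are indexed by the `d`-th coordinate, columns by all the other
coordinates. (The ordering of the columns does not affect the singular values.) -/
def RealTensor.matricization {D : ℕ} {n : Fin D → ℕ} (X : RealTensor n) (d : Fin D) :
    Matrix (Fin (n d)) ((j : {j : Fin D // j ≠ d}) → Fin (n j)) ℝ :=
  Matrix.of fun i J => X ((Equiv.piSplitAt d (fun j => Fin (n j))).symm (i, J))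

/-- The mode-`d` spectrum: the vector in `ℝ ^ (n d)` of the singular values of the mode-`d`
matricization, in decreasing order and with multiplicity. The matricization has `n d` rows, hence
at most `n d` nonzero singular values; the vector is completed by zeros. -/
def RealTensor.modeSpectrum {D : ℕ} {n : Fin D → ℕ} (X : RealTensor n) (d : Fin D) :
    Fin (n d) → ℝ :=
  fun k => (Matrix.toEuclideanLin (X.matricization d)).singularValues k

/-- The spectrum `σ(X) = D^(-1/2) (σ⁽¹⁾(X), …, σ⁽ᴰ⁾(X))`, a vector of Euclidean space of
dimension `∑ d, n d`. -/
def RealTensor.spectrumVec {D : ℕ} {n : Fin D → ℕ} (X : RealTensor n) :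
    EuclideanSpace ℝ (Σ d : Fin D, Fin (n d)) :=
  WithLp.toLp 2 fun dk => (1 / √(D : ℝ)) * X.modeSpectrum dk.1 dk.2

/-- The number of nonzero coordinates `‖s‖₀`. -/
def cardNonzero {ι : Type*} [Fintype ι] (s : EuclideanSpace ℝ ι) : ℕ :=
  {i : ι | s i ≠ 0}.ncard

/-- The dual Romera-Paredes--Pontil function `sup_{‖s‖₂ ≤ α} ⟨g, s⟩ - ‖s‖₀`. -/
def dualRPP {ι : Type*} [Fintype ι] (α : ℝ) (g : EuclideanSpace ℝ ι) : ℝ :=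
  sSup {t : ℝ | ∃ s : EuclideanSpace ℝ ι, ‖s‖ ≤ α ∧ t = inner ℝ g s - (cardNonzero s : ℝ)}

/-- The dual Romera-Paredes--Pontil function of a tensor, that is, of its spectrum. -/
def RealTensor.dualRPP {D : ℕ} {n : Fin D → ℕ} (α : ℝ) (X : RealTensor n) : ℝ :=
  _root_.dualRPP α X.spectrumVec

/-- The expression
`√(log p) ((1+N)^(D+1) - 2^(D+1))/(D+1) + (1/4) √(π q) (N + (N(1+N)^D - 2^D)/D
  + (2^(D+1) - (1+N)^(D+1))/(D(D+1))) - N(1+N)/2`. -/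
def rppBound (N D : ℕ) (p q : ℝ) : ℝ :=
  (√(Real.log p) * (((1 + N : ℝ) ^ (D + 1) - 2 ^ (D + 1)) / (D + 1))
    + 1 / 4 * √(Real.pi * q) *
      (N + (N * (1 + N : ℝ) ^ D - 2 ^ D) / D
        + (2 ^ (D + 1) - (1 + N : ℝ) ^ (D + 1)) / (D * (D + 1))))
  - (N * (1 + N) : ℝ) / 2

end

/-! ### Weyl's perturbation bound and the Frobenius bound for singular values. -/

section SingularValues

open Module

variable {E F : Type*} [NormedAddCommGroup E] [InnerProductSpace ℝ E] [FiniteDimensional ℝ E]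
  [NormedAddCommGroup F] [InnerProductSpace ℝ F] [FiniteDimensional ℝ F]

/-! The right-hand side is so large that Cauchy–Schwarz suffices. Dropping `‖s‖₀` gives `ω*(X) ≤ α
‖σ(X)‖ ≤ α ‖X‖_F`, because the squared singular values of each matricization sum to at most
`‖X‖_F²`. As `E ‖X‖_F² = ∏ n_d ≤ N ^ D`, the mean is at most `α √(N ^ D)`. Since `c ≥ 1` and `r n_*
≥ 1`, one has `p ≥ 3` and `q ≥ 1`, and then `sqrt_pow_le_rppBound` is pure calculus. Measurability
comes from continuity of singular values, by Weyl's inequality `LinearMap.singularValues_le_add`. -/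

theorem LinearMap.sum_sq_singularValues_mul_sq_inner (T : E →ₗ[ℝ] F) (x : E) :
    ∑ i : Fin (finrank ℝ E), T.singularValues i ^ 2 *
      inner ℝ (T.isSymmetric_adjoint_comp_self.eigenvectorBasis rfl i) x ^ 2 = ‖T x‖ ^ 2 := by
  set b := T.isSymmetric_adjoint_comp_self.eigenvectorBasis rfl
  rw [← real_inner_self_eq_norm_sq, ← LinearMap.adjoint_inner_right, ← b.sum_inner_mul_inner]
  refine Finset.sum_congr rfl fun i _ => ?_
  have h := T.isSymmetric_adjoint_comp_self.eigenvectorBasis_apply_self_apply rfl x i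
  rw [OrthonormalBasis.repr_apply_apply, OrthonormalBasis.repr_apply_apply] at h
  change inner ℝ (b i) (T.adjoint (T x)) = _ at h
  rw [h, T.sq_singularValues_fin rfl i, real_inner_comm (b i) x]
  simp only [RCLike.ofReal_real_eq_id, id_eq]
  change _ * (inner ℝ (b i) x) ^ 2 = inner ℝ (b i) x * (_ * inner ℝ (b i) x)
  ring

/-- Courant–Fischer argument: some `x ≠ 0` is orthogonal to the right singular vectors of `T` beyond
index `k` and to those of `S` before `k`. On it `T` stretches by at least its `k`-th singular value
and `S` by at most its own. -/
theorem LinearMap.singularValues_le_add (T S : E →ₗ[ℝ] F) {C : ℝ} (hC : 0 ≤ C)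
    (h : ∀ x, ‖T x - S x‖ ≤ C * ‖x‖) (k : ℕ) :
    T.singularValues k ≤ S.singularValues k + C := by
  rcases le_or_gt (finrank ℝ E) k with hk | hk
  · rw [T.singularValues_of_finrank_le hk]
    have := S.singularValues_nonneg k
    positivity
  set b := T.isSymmetric_adjoint_comp_self.eigenvectorBasis rfl with hb
  set c := S.isSymmetric_adjoint_comp_self.eigenvectorBasis rfl with hc
  -- Omitting index `k` leaves one constraint fewer than the dimension, so the kernel is nonzero.
  let φ : E →ₗ[ℝ] ({i : Fin (finrank ℝ E) // i ≠ ⟨k, hk⟩} → ℝ) :=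
    LinearMap.pi fun i => (innerSL ℝ (if k < i.1.1 then b i.1 else c i.1)).toLinearMap
  obtain ⟨x, hx, hx0⟩ := (Submodule.ne_bot_iff _).1 (φ.ker_ne_bot_of_finrank_lt (by
    simp only [finrank_fintype_fun_eq_card, ne_eq, Fintype.card_subtype_compl, Fintype.card_fin,
      Fintype.card_unique]
    omega))
  have hφ (i : Fin (finrank ℝ E)) (hi : i ≠ ⟨k, hk⟩) :
      inner ℝ (if k < i.1 then b i else c i) x = 0 := congrFun hx ⟨i, hi⟩
  have hT : (T.singularValues k * ‖x‖) ^ 2 ≤ ‖T x‖ ^ 2 := by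
    rw [← T.sum_sq_singularValues_mul_sq_inner, mul_pow, ← b.sum_sq_inner_right x, Finset.mul_sum]
    refine Finset.sum_le_sum fun i _ => ?_
    rcases lt_or_ge k i.1 with hi | hi
    · have := hφ i (by rintro rfl; simp at hi)
      rw [if_pos hi] at this
      simp [← hb, this]
    · gcongr
      · exact T.singularValues_nonneg k
      · exact T.singularValues_antitone hi
  have hS : ‖S x‖ ^ 2 ≤ (S.singularValues k * ‖x‖) ^ 2 := by
    rw [← S.sum_sq_singularValues_mul_sq_inner, mul_pow, ← c.sum_sq_inner_right x, Finset.mul_sum]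
    refine Finset.sum_le_sum fun i _ => ?_
    rcases lt_or_ge i.1 k with hi | hi
    · have := hφ i (by rintro rfl; simp at hi)
      rw [if_neg hi.le.not_gt] at this
      simp [← hc, this]
    · gcongr
      · exact S.singularValues_nonneg i
      · exact S.singularValues_antitone hi
  have hT' := le_of_sq_le_sq hT (norm_nonneg _)
  have hS' := le_of_sq_le_sq hS (mul_nonneg (S.singularValues_nonneg k) (norm_nonneg _))
  have htri : ‖T x‖ ≤ ‖S x‖ + ‖T x - S x‖ := by
    simpa using norm_add_le (S x) (T x - S x)
  have := h x
  refine le_of_mul_le_mul_right ?_ (norm_pos_iff.2 hx0)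
  linarith

theorem ContinuousLinearMap.lipschitzWith_singularValues (k : ℕ) :
    LipschitzWith 1 fun T : E →L[ℝ] F => (T : E →ₗ[ℝ] F).singularValues k :=
  LipschitzWith.of_le_add fun T S => by
    rw [dist_eq_norm]
    exact LinearMap.singularValues_le_add _ _ (norm_nonneg _) (fun x => (T - S).le_opNorm x) k

/-- Both sides compare with the trace of `T* T`; indices beyond the dimension contribute zero. -/
theorem LinearMap.sum_range_sq_singularValues_le {ι : Type*} [Fintype ι] (T : E →ₗ[ℝ] F)
    (b : OrthonormalBasis ι ℝ E) (m : ℕ) :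
    ∑ k ∈ Finset.range m, T.singularValues k ^ 2 ≤ ∑ i, ‖T (b i)‖ ^ 2 := by
  have htrace : ∑ k ∈ Finset.range (finrank ℝ E), T.singularValues k ^ 2 = ∑ i, ‖T (b i)‖ ^ 2 := by
    have h := (T.adjoint ∘ₗ T).trace_eq_sum_inner b
    rw [T.isSymmetric_adjoint_comp_self.trace_eq_sum_eigenvalues rfl] at h
    simp only [LinearMap.comp_apply, LinearMap.adjoint_inner_right,
      real_inner_self_eq_norm_sq] at h
    rw [← h, Finset.sum_range]
    exact Finset.sum_congr rfl fun i _ => T.sq_singularValues_fin rfl i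
  rw [← htrace]
  have hzero : ∀ k ≥ finrank ℝ E, T.singularValues k ^ 2 = 0 := fun k hk => by
    rw [T.singularValues_of_finrank_le hk, zero_pow two_ne_zero]
  rcases le_total m (finrank ℝ E) with hm | hm
  · exact Finset.sum_le_sum_of_subset_of_nonneg (Finset.range_mono hm) fun _ _ _ => sq_nonneg _
  · refine (Finset.sum_subset (Finset.range_mono hm) fun k _ hk => hzero k ?_).ge
    simpa using hk

theorem Matrix.continuous_toEuclideanLin {m n : Type*} [Fintype m] [Fintype n] [DecidableEq n] :
    Continuous fun A : Matrix m n ℝ => (Matrix.toEuclideanLin A).toContinuousLinearMap := by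
  let L : Matrix m n ℝ →ₗ[ℝ] (EuclideanSpace ℝ n →L[ℝ] EuclideanSpace ℝ m) :=
    (LinearMap.toContinuousLinearMap (𝕜 := ℝ) (E := EuclideanSpace ℝ n)
      (F' := EuclideanSpace ℝ m)).toLinearMap ∘ₗ
      (Matrix.toEuclideanLin (𝕜 := ℝ) (m := m) (n := n)).toLinearMap
  have h : Continuous L := L.continuous_of_finiteDimensional
  exact h

end SingularValues

/-! ### Continuity and norm of the tensor spectrum. -/

section Spectrum

variable {D : ℕ} {n : Fin D → ℕ}

theorem RealTensor.continuous_modeSpectrum (d : Fin D) (k : Fin (n d)) :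
    Continuous fun X : RealTensor n => X.modeSpectrum d k := by
  have hM : Continuous fun X : RealTensor n => X.matricization d :=
    continuous_matrix fun _ _ => continuous_apply _
  have h := (ContinuousLinearMap.lipschitzWith_singularValues
    (E := EuclideanSpace ℝ ((j : {j : Fin D // j ≠ d}) → Fin (n j)))
    (F := EuclideanSpace ℝ (Fin (n d))) k).continuous.comp
      (Matrix.continuous_toEuclideanLin.comp hM)
  exact h

theorem RealTensor.continuous_spectrumVec :
    Continuous fun X : RealTensor n => X.spectrumVec :=
  (PiLp.continuous_toLp 2 _).comp <| continuous_pi fun dk =>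
    continuous_const.mul (RealTensor.continuous_modeSpectrum dk.1 dk.2)

theorem RealTensor.sum_sq_modeSpectrum_le (X : RealTensor n) (d : Fin D) :
    ∑ k, X.modeSpectrum d k ^ 2 ≤ ∑ i, X i ^ 2 := by
  have h := LinearMap.sum_range_sq_singularValues_le (Matrix.toEuclideanLin (X.matricization d))
    (EuclideanSpace.basisFun _ ℝ) (n d)
  rw [Finset.sum_range] at h
  refine h.trans_eq ?_
  rw [← (Equiv.piSplitAt d fun j => Fin (n j)).symm.sum_comp, Fintype.sum_prod_type_right]
  refine Finset.sum_congr rfl fun J _ => ?_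
  rw [EuclideanSpace.norm_sq_eq]
  refine Finset.sum_congr rfl fun i _ => ?_
  simp [Matrix.toLpLin_apply, RealTensor.matricization]

theorem RealTensor.norm_spectrumVec_le (X : RealTensor n) :
    ‖X.spectrumVec‖ ≤ √(∑ i, X i ^ 2) := by
  refine Real.le_sqrt_of_sq_le ?_
  rw [EuclideanSpace.norm_sq_eq, Fintype.sum_sigma]
  have hle (d : Fin D) : ∑ k : Fin (n d), ‖X.spectrumVec ⟨d, k⟩‖ ^ 2
      ≤ (D : ℝ)⁻¹ * ∑ i, X i ^ 2 := by
    have : ∀ k : Fin (n d), ‖X.spectrumVec ⟨d, k⟩‖ ^ 2 = (D : ℝ)⁻¹ * X.modeSpectrum d k ^ 2 := by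
      intro k
      simp [RealTensor.spectrumVec, mul_pow]
    rw [Finset.sum_congr rfl fun k _ => this k, ← Finset.mul_sum]
    gcongr
    exact X.sum_sq_modeSpectrum_le d
  refine (Finset.sum_le_sum fun d _ => hle d).trans ?_
  rw [Finset.sum_const, Finset.card_univ, Fintype.card_fin, nsmul_eq_mul, ← mul_assoc]
  exact mul_le_of_le_one_left (by positivity) mul_inv_le_one

end Spectrum

/-! ### Growth and continuity of the dual function. -/

section DualRPP

variable {ι : Type*} [Fintype ι] {α : ℝ}

theorem inner_sub_cardNonzero_le (g : EuclideanSpace ℝ ι) {s : EuclideanSpace ℝ ι}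
    (hs : ‖s‖ ≤ α) : inner ℝ g s - (cardNonzero s : ℝ) ≤ α * ‖g‖ := by
  have h1 := real_inner_le_norm g s
  have h2 := mul_le_mul_of_nonneg_left hs (norm_nonneg g)
  have h3 : (0 : ℝ) ≤ cardNonzero s := Nat.cast_nonneg _
  linarith

theorem bddAbove_dualRPP (α : ℝ) (g : EuclideanSpace ℝ ι) :
    BddAbove {t : ℝ | ∃ s : EuclideanSpace ℝ ι, ‖s‖ ≤ α ∧
      t = inner ℝ g s - (cardNonzero s : ℝ)} :=
  ⟨α * ‖g‖, by rintro _ ⟨s, hs, rfl⟩; exact inner_sub_cardNonzero_le g hs⟩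

theorem inner_sub_cardNonzero_le_dualRPP (g : EuclideanSpace ℝ ι) {s : EuclideanSpace ℝ ι}
    (hs : ‖s‖ ≤ α) : inner ℝ g s - (cardNonzero s : ℝ) ≤ dualRPP α g :=
  le_csSup (bddAbove_dualRPP α g) ⟨s, hs, rfl⟩

theorem dualRPP_le (hα : 0 ≤ α) {g : EuclideanSpace ℝ ι} {a : ℝ}
    (h : ∀ s : EuclideanSpace ℝ ι, ‖s‖ ≤ α → inner ℝ g s - (cardNonzero s : ℝ) ≤ a) :
    dualRPP α g ≤ a :=
  csSup_le ⟨_, 0, by simpa using hα, rfl⟩ (by rintro _ ⟨s, hs, rfl⟩; exact h s hs)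

theorem dualRPP_nonneg (hα : 0 ≤ α) (g : EuclideanSpace ℝ ι) : 0 ≤ dualRPP α g := by
  simpa [cardNonzero] using
    inner_sub_cardNonzero_le_dualRPP g (s := 0) (by simpa using hα : ‖_‖ ≤ α)

theorem dualRPP_le_mul_norm (hα : 0 ≤ α) (g : EuclideanSpace ℝ ι) : dualRPP α g ≤ α * ‖g‖ :=
  dualRPP_le hα fun _ hs => inner_sub_cardNonzero_le g hs

theorem lipschitzWith_dualRPP (hα : 0 ≤ α) :
    LipschitzWith α.toNNReal (dualRPP α : EuclideanSpace ℝ ι → ℝ) :=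
  LipschitzWith.of_le_add_mul _ fun g g' => dualRPP_le hα fun s hs => by
    have h1 := inner_sub_cardNonzero_le_dualRPP g' hs
    have h2 := real_inner_le_norm (g - g') s
    have h3 := mul_le_mul_of_nonneg_left hs (norm_nonneg (g - g'))
    rw [inner_sub_left] at h2
    rw [Real.coe_toNNReal α hα, dist_eq_norm]
    linarith

variable {D : ℕ} {n : Fin D → ℕ}

theorem RealTensor.continuous_dualRPP (hα : 0 ≤ α) :
    Continuous fun X : RealTensor n => X.dualRPP α :=
  (lipschitzWith_dualRPP hα).continuous.comp RealTensor.continuous_spectrumVec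

theorem RealTensor.dualRPP_le_mul_sqrt (hα : 0 ≤ α) (X : RealTensor n) :
    X.dualRPP α ≤ α * √(∑ i, X i ^ 2) :=
  (dualRPP_le_mul_norm hα _).trans (mul_le_mul_of_nonneg_left X.norm_spectrumVec_le hα)

end DualRPP

/-! ### Numerical lower bounds for `rppBound`. -/

theorem pow_succ_sub_pow_succ_le {x y : ℝ} (hx : 0 ≤ x) (hxy : x ≤ y) (k : ℕ) :
    y ^ (k + 1) - x ^ (k + 1) ≤ (k + 1) * (y - x) * y ^ k := by
  induction k with
  | zero => simp
  | succ k ih =>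
    have h1 := mul_le_mul_of_nonneg_left ih (hx.trans hxy)
    have h2 := mul_le_mul_of_nonneg_right (pow_le_pow_left₀ hx hxy (k + 1)) (sub_nonneg.2 hxy)
    push_cast
    ring_nf at h1 h2 ⊢
    linarith

/-- The midpoint half of the Hermite–Hadamard inequality for powers, together with midpoint
convexity. -/
theorem midpoint_pow_le {m h : ℝ} (hh : 0 ≤ h) (hm : h ≤ m) (k : ℕ) :
    2 * h * (k + 1) * m ^ k ≤ (m + h) ^ (k + 1) - (m - h) ^ (k + 1) ∧
      2 * m ^ (k + 1) ≤ (m + h) ^ (k + 1) + (m - h) ^ (k + 1) := by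
  have hm0 := hh.trans hm
  induction k with
  | zero => constructor <;> norm_num <;> linarith
  | succ k ih =>
    -- With `a = (m + h)^(k+1)` and `b = (m - h)^(k+1)`, the next difference is `m(a - b) + h(a +
    -- b)` and the next sum is `m(a + b) + h(a - b)`, so each part needs both hypotheses.
    obtain ⟨h1, h2⟩ := ih
    have h3 := mul_le_mul_of_nonneg_left h1 hm0
    have h4 := mul_le_mul_of_nonneg_left h2 hh
    have h5 := mul_le_mul_of_nonneg_left h2 hm0
    have h6 : 0 ≤ h * ((m + h) ^ (k + 1) - (m - h) ^ (k + 1)) :=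
      mul_nonneg hh (le_trans (by positivity) h1)
    rw [pow_succ (m + h) (k + 1), pow_succ (m - h) (k + 1), pow_succ m (k + 1)]
    generalize (m + h) ^ (k + 1) = a at *
    generalize (m - h) ^ (k + 1) = b at *
    push_cast
    rw [pow_succ m k] at *
    generalize m ^ k = c at *
    constructor <;> linarith

/-- Here `p ≥ 3 > e` gives `√(log p) ≥ 1`, and `√(πq) ≥ 3/2` produces `3/8 = 1/4 · 3/2`. The factor
next to `√(πq)` is at least `N`: its remaining terms combine to a nonnegative multiple of `N(1+N)^D
- 2^D - ∫ x^D` over `[2, 1+N]`. -/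
theorem le_rppBound {N D : ℕ} (hD : 1 ≤ D) (hN : 2 ≤ N) {p q : ℝ} (hp : 3 ≤ p) (hq : 1 ≤ q) :
    ((1 + N : ℝ) ^ (D + 1) - 2 ^ (D + 1)) / (D + 1) + 3 / 8 * N - (N * (1 + N) : ℝ) / 2
      ≤ rppBound N D p q := by
  have hN' : (2 : ℝ) ≤ N := by exact_mod_cast hN
  have hD' : (1 : ℝ) ≤ D := by exact_mod_cast hD
  have hlog : 1 ≤ √(Real.log p) := by
    rw [Real.one_le_sqrt, Real.le_log_iff_exp_le (by linarith)]
    linarith [Real.exp_one_lt_d9]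
  have hsqrt : 3 / 2 ≤ √(Real.pi * q) := by
    refine Real.le_sqrt_of_sq_le ?_
    nlinarith [Real.pi_gt_three]
  have hA : 0 ≤ ((1 + N : ℝ) ^ (D + 1) - 2 ^ (D + 1)) / (D + 1) :=
    div_nonneg (sub_nonneg.2 (pow_le_pow_left₀ (by norm_num) (by linarith) _)) (by positivity)
  have hv : ((1 + N : ℝ) ^ (D + 1) - 2 ^ (D + 1)) / (D + 1) ≤ N * (1 + N : ℝ) ^ D - 2 ^ D := by
    have h1 := pow_succ_sub_pow_succ_le (x := 2) (y := 1 + N) (by norm_num) (by linarith) D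
    have h2 : (2 : ℝ) ^ D ≤ (1 + N) ^ D := pow_le_pow_left₀ (by norm_num) (by linarith) D
    have h3 : ((1 + N : ℝ) ^ (D + 1) - 2 ^ (D + 1)) / (D + 1) ≤ (N - 1) * (1 + N : ℝ) ^ D := by
      rw [div_le_iff₀ (by positivity)]
      linarith
    linarith
  have hB : (N : ℝ) ≤ N + (N * (1 + N : ℝ) ^ D - 2 ^ D) / D
        + (2 ^ (D + 1) - (1 + N : ℝ) ^ (D + 1)) / (D * (D + 1)) := by
    have heq : (N * (1 + N : ℝ) ^ D - 2 ^ D) / D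
        + (2 ^ (D + 1) - (1 + N : ℝ) ^ (D + 1)) / (D * (D + 1))
        = ((N * (1 + N : ℝ) ^ D - 2 ^ D)
          - ((1 + N : ℝ) ^ (D + 1) - 2 ^ (D + 1)) / (D + 1)) / D := by
      field_simp
      ring
    have : 0 ≤ ((N * (1 + N : ℝ) ^ D - 2 ^ D)
          - ((1 + N : ℝ) ^ (D + 1) - 2 ^ (D + 1)) / (D + 1)) / D :=
      div_nonneg (sub_nonneg.2 hv) (by positivity)
    linarith
  unfold rppBound
  have h1 := mul_le_mul_of_nonneg_right hlog hA
  have h2 := mul_le_mul hsqrt hB (by positivity) (by positivity)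
  linarith

theorem sqrt_pow_le_rppBound {N D : ℕ} (hD : 1 ≤ D) (hN : 2 ≤ N) {p q : ℝ} (hp : 3 ≤ p)
    (hq : 1 ≤ q) : √((N : ℝ) ^ D) ≤ 8 * √2 * rppBound N D p q := by
  have hN' : (2 : ℝ) ≤ N := by exact_mod_cast hN
  have hlow := le_rppBound hD hN hp hq
  have h2 : (1 : ℝ) ≤ √2 := by rw [Real.one_le_sqrt]; norm_num
  suffices h : √((N : ℝ) ^ D) ≤ 8 * rppBound N D p q by
    have := mul_le_mul_of_nonneg_right h2 ((Real.sqrt_nonneg _).trans h)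
    linarith
  have hsq : √(N : ℝ) ≤ (N + 1) / 2 := by
    rw [Real.sqrt_le_left (by positivity)]
    nlinarith [sq_nonneg ((N : ℝ) - 1)]
  -- For `D = 1` the lower bound is `7N/8 - 3/2`, where the `3N/8` term is indispensable at `N = 2`.
  rcases hD.eq_or_lt with rfl | hD2
  · norm_num at hlow ⊢
    nlinarith
  -- For `D ≥ 2`, the integral of `x^D` over `[2, 1+N]` is at least `(N - 1) M`, with `M` the `D`-th
  -- power of the midpoint. Half of this absorbs `N(1+N)/2`, the other half dominates `√(N ^ D)`.
  have hmid := (midpoint_pow_le (m := (N + 3) / 2) (h := (N - 1) / 2) (by linarith) (by linarith)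
    D).1
  rw [show ((N : ℝ) + 3) / 2 + (N - 1) / 2 = 1 + N by ring,
    show ((N : ℝ) + 3) / 2 - (N - 1) / 2 = 2 by ring] at hmid
  have hA : (N - 1) * (((N : ℝ) + 3) / 2) ^ D
      ≤ ((1 + N : ℝ) ^ (D + 1) - 2 ^ (D + 1)) / (D + 1) := by
    rw [le_div_iff₀ (by positivity)]
    linarith
  have hroot : √((N : ℝ) ^ D) ≤ (((N : ℝ) + 3) / 2) ^ D := by
    refine Real.sqrt_le_iff.2 ⟨by positivity, ?_⟩
    rw [← pow_mul, mul_comm, pow_mul]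
    exact pow_le_pow_left₀ (by positivity) (by nlinarith) D
  have hpow : (((N : ℝ) + 3) / 2) ^ 2 ≤ (((N : ℝ) + 3) / 2) ^ D :=
    pow_le_pow_right₀ (by linarith) hD2
  generalize (((N : ℝ) + 3) / 2) ^ D = M at *
  have hquad : (N : ℝ) * (1 + N) / 2 ≤ (N - 1) / 2 * M := by
    have := mul_le_mul_of_nonneg_left hpow (by linarith : (0 : ℝ) ≤ (N - 1) / 2)
    refine le_trans ?_ this
    nlinarith [mul_nonneg (sub_nonneg.2 hN') (sub_nonneg.2 hN'),
      mul_nonneg (sub_nonneg.2 hN') (mul_nonneg (sub_nonneg.2 hN') (sub_nonneg.2 hN'))]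
  have hM : 0 ≤ M := (Real.sqrt_nonneg _).trans hroot
  have := mul_le_mul_of_nonneg_right hN' hM
  linarith

theorem mainTheorem5 {Ω : Type*} [MeasurableSpace Ω] (P : Measure Ω) [IsProbabilityMeasure P]
    (D : ℕ) (hD : 1 ≤ D) (n : Fin D → ℕ) (hn : ∀ d, 1 ≤ n d)
    (N : ℕ) (hN : N = ∑ d, n d) (hN2 : 2 ≤ N)
    (nmax : ℕ) (hnmax : nmax = Finset.univ.sup n)
    (X : Ω → RealTensor n)
    (hlaw : ∀ i, HasLaw (fun w => X w i) (gaussianReal 0 1) P)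
    (hindep : iIndepFun (fun i w => X w i) P)
    (α : ℝ) (hα : 0 ≤ α) :
    Integrable (fun w => (X w).dualRPP α) P ∧
    ∀ r c : ℕ, 1 ≤ r → r ≤ N →
      (c = (r - 1).choose (D - 1) ∨ c = (D - 1).choose (r - 1)) → c ≠ 0 →
      ∀ p q : ℝ, p = c * 3 ^ (r * nmax) → q = r * nmax + ((r : ℝ) / D) ^ D →
        ∫ w, (X w).dualRPP α ∂P ≤ 8 * √2 * α * rppBound N D p q := by
  have hXm : AEMeasurable X P := aemeasurable_pi_lambda _ fun i => (hlaw i).aemeasurable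
  have hmem (i) : MemLp (fun w => X w i) 2 P := by
    have h := memLp_id_gaussianReal' (μ := 0) (v := 1) 2 (by simp)
    rw [← (hlaw i).map_eq] at h
    exact h.comp_of_map (hlaw i).aemeasurable
  have hsqint (i) : Integrable (fun w => X w i ^ 2) P := (hmem i).integrable_sq
  have hsq (i) : ∫ w, X w i ^ 2 ∂P = 1 := by
    have hv := (hlaw i).variance_eq
    rw [variance_id_gaussianReal, variance_of_integral_eq_zero (hlaw i).aemeasurable
      (by rw [(hlaw i).integral_eq, integral_id_gaussianReal])] at hv
    simpa using hv
  let V : ℝ := ∏ d, (n d : ℝ)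
  have hV : 0 < V := Finset.prod_pos fun d _ => by exact_mod_cast hn d
  have hFint : Integrable (fun w => ∑ i, X w i ^ 2) P := integrable_finsetSum _ fun i _ => hsqint i
  have hF : ∫ w, ∑ i, X w i ^ 2 ∂P = V := by
    rw [integral_finsetSum _ fun i _ => hsqint i]
    simp [hsq, V]
  -- AM–GM for `√S` with weight `√V` replaces Jensen: the majorant is integrable, and its mean is
  -- exactly `α √V` because `S` has mean `V`.
  have hbound (Y : RealTensor n) :
      Y.dualRPP α ≤ α * ((∑ i, Y i ^ 2) / (2 * √V) + √V / 2) := by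
    refine (Y.dualRPP_le_mul_sqrt hα).trans (mul_le_mul_of_nonneg_left ?_ hα)
    have hs := Real.sqrt_pos.2 hV
    have hY := Real.sq_sqrt (Finset.sum_nonneg fun i _ => sq_nonneg (Y i) : 0 ≤ ∑ i, Y i ^ 2)
    rw [div_add_div _ _ (by positivity) two_ne_zero, le_div_iff₀ (by positivity)]
    nlinarith [sq_nonneg (√(∑ i, Y i ^ 2) - √V)]
  have hgint : Integrable (fun w => α * ((∑ i, X w i ^ 2) / (2 * √V) + √V / 2)) P :=
    ((hFint.div_const _).add (integrable_const _)).const_mul α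
  have hint : Integrable (fun w => (X w).dualRPP α) P :=
    hgint.mono' ((RealTensor.continuous_dualRPP hα).measurable.comp_aemeasurable
      hXm).aestronglyMeasurable (ae_of_all _ fun w => by
        rw [RealTensor.dualRPP, Real.norm_of_nonneg (dualRPP_nonneg hα _)]
        exact hbound (X w))
  refine ⟨hint, ?_⟩
  rintro r c hr - - hc p q rfl rfl
  have hmean : ∫ w, (X w).dualRPP α ∂P ≤ α * √V := by
    refine (integral_mono hint hgint fun w => hbound (X w)).trans_eq ?_
    rw [integral_const_mul, integral_add (hFint.div_const _) (integrable_const _),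
      integral_div, hF, integral_const, probReal_univ, one_smul]
    have hs := Real.sqrt_pos.2 hV
    have hVV := Real.sq_sqrt hV.le
    congr 1
    field_simp
    linarith
  have hVle : V ≤ (N : ℝ) ^ D := by
    refine (Finset.prod_le_prod (fun _ _ => by positivity) fun d _ =>
      (Nat.cast_le (α := ℝ)).2 (hN ▸ Finset.single_le_sum (f := n) (fun _ _ => Nat.zero_le _)
        (Finset.mem_univ d))).trans_eq ?_
    simp
  have hrn : 1 ≤ r * nmax := by
    have h0 : n ⟨0, hD⟩ ≤ nmax := hnmax ▸ Finset.le_sup (Finset.mem_univ _)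
    exact Nat.mul_pos hr ((hn _).trans h0)
  have hp : (3 : ℝ) ≤ c * 3 ^ (r * nmax) := by
    have h1 : (1 : ℝ) ≤ c := by exact_mod_cast Nat.one_le_iff_ne_zero.2 hc
    have h2 : (3 : ℝ) ^ 1 ≤ 3 ^ (r * nmax) := pow_le_pow_right₀ (by norm_num) hrn
    nlinarith
  have hq : (1 : ℝ) ≤ r * nmax + ((r : ℝ) / D) ^ D := by
    have h1 : (1 : ℝ) ≤ r * nmax := by exact_mod_cast hrn
    have h2 : (0 : ℝ) ≤ ((r : ℝ) / D) ^ D := by positivity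
    linarith
  have hnum := (Real.sqrt_le_sqrt hVle).trans (sqrt_pow_le_rppBound hD hN2 hp hq)
  have := mul_le_mul_of_nonneg_left hnum hα
  linarith
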